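/- Let $D^n\subset\mathbb R^n$ be the closed unit disk, and let $f_1,f_2:D^n\to\mathbb R^n$ be orientation-preserving smooth ($C^\infty$) embeddings with $f_1(0)=f_2(0)=0$. Then there exists a smooth isotopy $f_2^{(t)}:D^n\to\mathbb R^n$, $t\in[0,1]$ (a family of maps, jointly smooth in $(t,x)\in[0,1]\times D^n$), with $f_2^{(0)}=f_2$, such that: (1) for every $t\in[0,1]$, $f_2^{(t)}$ is an orientation-preserving smooth embedding with $f_2^{(t)}(0)=0$, and there is a neighbourhood of $\partial D^n$ in $D^n$ on which $f_2^{(t)}=f_2$ for all $t\in[0,1]$; (2) there exists a neighbourhood $U$ of $0$ in $D^n$, with closure $\overline U$ contained in the interior of $D^n$, such that $f_2^{(1)}|_U=f_1|_U$. Furthermore, such an isotopy can be realized by a diffeotopy of $\mathbb R^n$ with support contained in $f_2(D^n)$: the isotopy can be chosen so that there are diffeomorphisms $H_t:\mathbb R^n\to\mathbb R^n$, $t\in[0,1]$, jointly smooth in $(t,y)\in[0,1]\times\mathbb R^n$, with $H_0=\mathrm{id}$, with the closure of $\{y : H_t(y)\neq y \text{ for some } t\in[0,1]\}$ contained in $f_2(D^n)$,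 and with $f_2^{(t)}=H_t\circ f_2$ for all $t\in[0,1]$. -/

import Mathlib

open Set Topology
open scoped ContDiff Manifold

/-- The closed unit disk `D^n` in Euclidean space `ℝ^n`. -/
def Disk (n : ℕ) : Set (EuclideanSpace ℝ (Fin n)) := Metric.closedBall 0 1

/-- The boundary sphere `∂D^n`. -/
def DiskBoundary (n : ℕ) : Set (EuclideanSpace ℝ (Fin n)) := Metric.sphere 0 1

/-- `f` restricts to a smooth embedding `D^n → ℝ^n`: a smooth immersion that is a homeomorphism
onto its image.  Only the values of `f` on `D^n` matter. -/
structure IsSmoothDiskEmbedding {n : ℕ}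
    (f : EuclideanSpace ℝ (Fin n) → EuclideanSpace ℝ (Fin n)) : Prop where
  smooth : ContDiffOn ℝ ∞ f (Disk n)
  immersion : ∀ x ∈ Disk n, Function.Injective (fderivWithin ℝ f (Disk n) x)
  embedding : IsEmbedding ((Disk n).domRestrict f)

/-- `f : D^n → ℝ^n` preserves the standard orientation: its Jacobian determinant is positive at
every point of `D^n`. -/
def IsOrientationPreservingOnDisk {n : ℕ}
    (f : EuclideanSpace ℝ (Fin n) → EuclideanSpace ℝ (Fin n)) : Prop :=
  ∀ x ∈ Disk n, 0 < (fderivWithin ℝ f (Disk n) x).det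

/-- `F t`, `t ∈ [0,1]`, is a (smooth) isotopy of the map `f : D^n → ℝ^n`, i.e. a family of smooth
embeddings of `D^n`, jointly smooth on `[0,1] × D^n`, that starts at `f`. -/
structure IsDiskIsotopyOf {n : ℕ}
    (F : ℝ → EuclideanSpace ℝ (Fin n) → EuclideanSpace ℝ (Fin n))
    (f : EuclideanSpace ℝ (Fin n) → EuclideanSpace ℝ (Fin n)) : Prop where
  smooth : ContDiffOn ℝ ∞
    (fun p : ℝ × EuclideanSpace ℝ (Fin n) => F p.1 p.2) (Icc (0 : ℝ) 1 ×ˢ Disk n)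
  embedding : ∀ t ∈ Icc (0 : ℝ) 1, IsSmoothDiskEmbedding (F t)
  start : ∀ x ∈ Disk n, F 0 x = f x

/-- `H t`, `t ∈ [0,1]`, is a diffeotopy of `ℝ^n`: a family of diffeomorphisms of `ℝ^n`,
jointly smooth on `[0,1] × ℝ^n`, that starts at the identity. -/
structure IsDiffeotopy {n : ℕ}
    (H : ℝ → EuclideanSpace ℝ (Fin n) → EuclideanSpace ℝ (Fin n)) : Prop where
  smooth : ContDiffOn ℝ ∞
    (fun p : ℝ × EuclideanSpace ℝ (Fin n) => H p.1 p.2) (Icc (0 : ℝ) 1 ×ˢ univ)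
  diffeo : ∀ t ∈ Icc (0 : ℝ) 1,
    ∃ Φ : EuclideanSpace ℝ (Fin n) ≃ₘ^∞⟮𝓘(ℝ, EuclideanSpace ℝ (Fin n)),
      𝓘(ℝ, EuclideanSpace ℝ (Fin n))⟯ EuclideanSpace ℝ (Fin n), ∀ y, Φ y = H t y
  start : ∀ y, H 0 y = y

/-- The support of a diffeotopy: the closure of the set of points moved at some time. -/
def diffeotopySupport {n : ℕ}
    (H : ℝ → EuclideanSpace ℝ (Fin n) → EuclideanSpace ℝ (Fin n)) :
    Set (EuclideanSpace ℝ (Fin n)) :=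
  closure {y | ∃ t ∈ Icc (0 : ℝ) 1, H t y ≠ y}

/-! Only the germ `g = f₁ ∘ f₂⁻¹` at the origin matters: if `g` is the end germ of a diffeotopy `H`
supported in a small ball, then `H t ∘ f₂` is the required isotopy. Such germs (`IsRealizable`) are
closed under composition, so `g` may be factored as its derivative after a germ tangent to the
identity.

A germ with derivative near the identity is realized by `y + t • ψ y • (g y - y)` with a cutoff `ψ`
(`exists_pos_forall_isRealizable_of_fderiv_near_id`). In particular the linear maps near `1` are
realizable, so those realizable together with their inverses form an open, hence closed, subgroup of
the invertible operators (`isClopen_realizableUnits`). It contains every operator joined to `1` by a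
segment of invertibles, and products of these exhaust positive determinant
(`Matrix.induction_of_det_pos`). -/

/-! ### Diffeotopies with small support and germs near the identity -/

section Diffeotopy

variable {E : Type*} [NormedAddCommGroup E] [NormedSpace ℝ E]

/-- A diffeotopy of `E`, smooth for all times, that fixes the origin, is the identity outside the
ball of radius `ε`, and consists of orientation-preserving maps. -/
structure IsBallDiffeotopy (ε : ℝ) (H : ℝ → E → E) : Prop where
  contDiff : ContDiff ℝ ∞ (fun p : ℝ × E => H p.1 p.2)
  diffeo : ∀ t ∈ Icc (0 : ℝ) 1,
    ∃ Φ : E ≃ₘ^∞⟮𝓘(ℝ, E), 𝓘(ℝ, E)⟯ E, ∀ y, Φ y = H t y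
  start : ∀ y, H 0 y = y
  eq_self : ∀ t y, ε ≤ ‖y‖ → H t y = y
  map_zero : ∀ t, H t 0 = 0
  det_pos : ∀ t ∈ Icc (0 : ℝ) 1, ∀ y, 0 < (fderiv ℝ (H t) y).det

/-- The germ of `g` at the origin is the germ of the end map of diffeotopies with arbitrarily
small support. -/
def IsRealizable (g : E → E) : Prop :=
  ∀ ε > 0, ∃ H : ℝ → E → E, IsBallDiffeotopy ε H ∧ H 1 =ᶠ[𝓝 0] g

theorem IsBallDiffeotopy.contDiff_apply {ε : ℝ} {H : ℝ → E → E} (h : IsBallDiffeotopy ε H)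
    (t : ℝ) : ContDiff ℝ ∞ (H t) :=
  h.contDiff.comp (contDiff_const.prodMk contDiff_id : ContDiff ℝ ∞ fun y : E => (t, y))

theorem ContinuousLinearMap.det_mul' (A B : E →L[ℝ] E) : (A.comp B).det = A.det * B.det :=
  LinearMap.det_comp (A : E →ₗ[ℝ] E) (B : E →ₗ[ℝ] E)

theorem IsBallDiffeotopy.comp {ε : ℝ} {H K : ℝ → E → E} (hH : IsBallDiffeotopy ε H)
    (hK : IsBallDiffeotopy ε K) : IsBallDiffeotopy ε (fun t y => H t (K t y)) where
  contDiff := hH.contDiff.comp (contDiff_fst.prodMk hK.contDiff)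
  diffeo t ht := by
    obtain ⟨Φ, hΦ⟩ := hH.diffeo t ht
    obtain ⟨Ψ, hΨ⟩ := hK.diffeo t ht
    exact ⟨Ψ.trans Φ, fun y => by simp [hΦ, hΨ]⟩
  start y := by rw [hK.start, hH.start]
  eq_self t y hy := by rw [hK.eq_self t y hy, hH.eq_self t y hy]
  map_zero t := by rw [hK.map_zero, hH.map_zero]
  det_pos t ht y := by
    have h1 := ((hH.contDiff_apply t).differentiable (by simp)) (K t y)
    have h2 := ((hK.contDiff_apply t).differentiable (by simp)) y
    have : fderiv ℝ (fun y => H t (K t y)) y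
        = (fderiv ℝ (H t) (K t y)).comp (fderiv ℝ (K t) y) := fderiv_comp y h1 h2
    rw [this, ContinuousLinearMap.det_mul']
    exact mul_pos (hH.det_pos t ht _) (hK.det_pos t ht _)

theorem IsRealizable.comp {g h : E → E} (hg : IsRealizable g) (hh : IsRealizable h) :
    IsRealizable (g ∘ h) := by
  intro ε hε
  obtain ⟨H, hH, hHg⟩ := hg ε hε
  obtain ⟨K, hK, hKh⟩ := hh ε hε
  refine ⟨_, hH.comp hK, ?_⟩
  -- `K 1` fixes the origin, so the germ of `H 1` there determines that of the composite.
  have hc : Filter.Tendsto (K 1) (𝓝 0) (𝓝 0) := by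
    simpa [hK.map_zero] using (hK.contDiff_apply 1).continuous.tendsto 0
  filter_upwards [hc.eventually hHg, hKh] with y h1 h2
  rw [h1, h2, Function.comp]

theorem IsRealizable.congr {g h : E → E} (hg : IsRealizable g) (hgh : g =ᶠ[𝓝 0] h) :
    IsRealizable h := fun ε hε =>
  let ⟨H, hH, hHg⟩ := hg ε hε
  ⟨H, hH, hHg.trans hgh⟩

/-- A kernel vector of `id + s • B` would satisfy `‖x‖ ≤ ‖B‖ * ‖x‖`, so the determinant never
vanishes along the segment and keeps the sign it has at `s = 0`. -/
theorem ContinuousLinearMap.det_id_add_pos [FiniteDimensional ℝ E] {B : E →L[ℝ] E}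
    (hB : ‖B‖ < 1) : 0 < (ContinuousLinearMap.id ℝ E + B).det := by
  have hne : ∀ s ∈ Icc (0 : ℝ) 1, (ContinuousLinearMap.id ℝ E + s • B).det ≠ 0 := by
    intro s hs h0
    obtain ⟨x, hx, hx0⟩ := (LinearMap.hasEigenvalue_zero_tfae
      ((ContinuousLinearMap.id ℝ E + s • B : E →L[ℝ] E) : E →ₗ[ℝ] E)).out 3 5 |>.1 h0
    have h1 : x = -(s • B x) := eq_neg_of_add_eq_zero_left (by simpa using hx0)
    have h2 : ‖x‖ ≤ ‖B‖ * ‖x‖ := by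
      calc ‖x‖ = s * ‖B x‖ := by
            conv_lhs => rw [h1]
            rw [norm_neg, norm_smul, Real.norm_of_nonneg hs.1]
        _ ≤ 1 * ‖B x‖ := by gcongr; exact hs.2
        _ ≤ ‖B‖ * ‖x‖ := by rw [one_mul]; exact B.le_opNorm x
    have h3 : 0 < ‖x‖ := norm_pos_iff.2 hx
    nlinarith
  have hcont : ContinuousOn (fun s : ℝ => (ContinuousLinearMap.id ℝ E + s • B).det) (Icc 0 1) :=
    (ContinuousLinearMap.continuous_det.comp (by fun_prop)).continuousOn
  by_contra! hneg
  have h0 : (0 : ℝ) ∈ Icc ((ContinuousLinearMap.id ℝ E + (1 : ℝ) • B).det)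
      ((ContinuousLinearMap.id ℝ E + (0 : ℝ) • B).det) := by
    constructor
    · simpa using hneg
    · simp [ContinuousLinearMap.det]
  obtain ⟨s, hs, hs0⟩ := intermediate_value_Icc' zero_le_one hcont h0
  exact hne s hs hs0

/-- Since `u` is `1/2`-Lipschitz, `id + u` is a global homeomorphism as a small Lipschitz
perturbation of the identity; its derivative is invertible everywhere, so the inverse is smooth. -/
theorem exists_diffeomorph_id_add [FiniteDimensional ℝ E] {u : E → E} (hu : ContDiff ℝ ∞ u)
    (hu' : ∀ x, ‖fderiv ℝ u x‖ ≤ 1 / 2) :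
    ∃ Φ : E ≃ₘ^∞⟮𝓘(ℝ, E), 𝓘(ℝ, E)⟯ E, ∀ y, Φ y = y + u y := by
  have hlip : LipschitzWith (1 / 2) u :=
    lipschitzWith_of_nnnorm_fderiv_le (hu.differentiable (by simp))
      fun x => by simpa [← NNReal.coe_le_coe] using hu' x
  have happ : ApproximatesLinearOn (fun y => y + u y)
      ((ContinuousLinearEquiv.refl ℝ E : E ≃L[ℝ] E) : E →L[ℝ] E) univ (1 / 2) := by
    rw [ApproximatesLinearOn.approximatesLinearOn_iff_lipschitzOnWith]
    convert! hlip.lipschitzOnWith (s := univ) using 1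
    ext x
    simp
  have hc : Subsingleton E ∨ (1 / 2 : NNReal) <
      ‖((ContinuousLinearEquiv.refl ℝ E).symm : E →L[ℝ] E)‖₊⁻¹ := by
    rcases subsingleton_or_nontrivial E with h | h
    · exact Or.inl h
    · right
      have : ‖((ContinuousLinearEquiv.refl ℝ E).symm : E →L[ℝ] E)‖₊ = 1 := by
        ext; exact ContinuousLinearMap.norm_id
      rw [this, ← NNReal.coe_lt_coe]
      norm_num
  let e : E ≃ₜ E := happ.toHomeomorph _ hc
  have he : ∀ y, e y = y + u y := fun y => rfl
  have hsm : ContDiff ℝ ∞ e := contDiff_id.add hu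
  have hdet : ∀ a, (ContinuousLinearMap.id ℝ E + fderiv ℝ u a).det ≠ 0 := fun a =>
    (ContinuousLinearMap.det_id_add_pos (lt_of_le_of_lt (hu' a) (by norm_num))).ne'
  have hsymm : ContDiff ℝ ∞ e.symm := by
    refine e.contDiff_symm (f₀' := fun a =>
      ContinuousLinearMap.toContinuousLinearEquivOfDetNeZero _ (hdet a)) (fun a => ?_) hsm
    rw [ContinuousLinearMap.coe_toContinuousLinearEquivOfDetNeZero]
    exact (hasFDerivAt_id a).add (hu.differentiable (by simp) a).hasFDerivAt
  exact ⟨⟨e.toEquiv, hsm.contMDiff, hsymm.contMDiff⟩, he⟩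

theorem isBallDiffeotopy_id_add_smul [FiniteDimensional ℝ E] {u : E → E} {ε : ℝ}
    (hu : ContDiff ℝ ∞ u) (hu' : ∀ x, ‖fderiv ℝ u x‖ ≤ 1 / 2) (hu0 : u 0 = 0)
    (hε : ∀ y, ε ≤ ‖y‖ → u y = 0) : IsBallDiffeotopy ε (fun t y => y + t • u y) := by
  have hd : ∀ (t : ℝ) x, HasFDerivAt (fun y => t • u y) (t • fderiv ℝ u x) x := fun t x =>
    (hu.differentiable (by simp) x).hasFDerivAt.const_smul t
  have hn : ∀ t ∈ Icc (0 : ℝ) 1, ∀ x, ‖t • fderiv ℝ u x‖ ≤ 1 / 2 := by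
    intro t ht x
    rw [norm_smul, Real.norm_of_nonneg ht.1]
    nlinarith [hu' x, ht.1, ht.2, norm_nonneg (fderiv ℝ u x)]
  refine ⟨?_, fun t ht => ?_, fun y => by simp, fun t y hy => by simp [hε y hy],
    fun t => by simp [hu0], fun t ht y => ?_⟩
  · exact contDiff_snd.add (contDiff_fst.smul (hu.comp contDiff_snd))
  · exact exists_diffeomorph_id_add (contDiff_const.smul hu) fun x => by
      rw [(hd t x).fderiv]; exact hn t ht x
  · have : fderiv ℝ (fun y => y + t • u y) y
        = ContinuousLinearMap.id ℝ E + t • fderiv ℝ u y := ((hasFDerivAt_id y).add (hd t y)).fderiv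
    rw [this]
    exact ContinuousLinearMap.det_id_add_pos (lt_of_le_of_lt (hn t ht y) (by norm_num))

/-- Shrinking the cutoff to scale `δ` multiplies its derivative by `δ⁻¹`, but `g - id` is `O(δ)`
there. The two cancel, so `c` depends only on the bump function, not on `g` or `ε`. -/
theorem exists_pos_forall_isRealizable_of_fderiv_near_id [FiniteDimensional ℝ E] :
    ∃ c > 0, ∀ (g : E → E) (W : Set E), IsOpen W → 0 ∈ W → ContDiffOn ℝ ∞ g W → g 0 = 0 →
      ‖fderiv ℝ g 0 - ContinuousLinearMap.id ℝ E‖ < c → IsRealizable g := by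
  let χ : ContDiffBump (0 : E) := ⟨1, 2, one_pos, one_lt_two⟩
  obtain ⟨C, hC⟩ := (χ.contDiff (n := 1)).lipschitzWith_of_hasCompactSupport
    χ.hasCompactSupport one_ne_zero
  have hC0 : (0 : ℝ) ≤ C := C.2
  -- Chosen so that the product-rule bound `c + 2 * C * c` equals `1 / 2`.
  refine ⟨1 / (2 * (2 * C + 1)), by positivity, ?_⟩
  intro g W hW h0W hg hg0 hc ε hε
  set c : ℝ := 1 / (2 * (2 * C + 1)) with hcdef
  have hcpos : 0 < c := by positivity
  set v : E → E := fun x => g x - x with hv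
  have hvW : ContDiffOn ℝ ∞ v W := hg.sub contDiffOn_id
  have hvd : ∀ x ∈ W, DifferentiableAt ℝ v x := fun x hx =>
    (hvW.contDiffAt (hW.mem_nhds hx)).differentiableAt (by simp)
  have hv0 : v 0 = 0 := by simp [hv, hg0]
  have hDv0 : ‖fderiv ℝ v 0‖ < c := by
    have : fderiv ℝ v 0 = fderiv ℝ g 0 - ContinuousLinearMap.id ℝ E :=
      (((hg.contDiffAt (hW.mem_nhds h0W)).differentiableAt (by simp)).hasFDerivAt.sub
        (hasFDerivAt_id 0)).fderiv
    rwa [this]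
  have hcontD : ContinuousAt (fderiv ℝ v) 0 :=
    (hvW.continuousOn_fderiv_of_isOpen hW (by simp)).continuousAt (hW.mem_nhds h0W)
  have hev : ∀ᶠ x in 𝓝 (0 : E), x ∈ W ∧ ‖fderiv ℝ v x‖ < c :=
    (hW.eventually_mem h0W).and (hcontD.norm.eventually_lt continuousAt_const hDv0)
  obtain ⟨r, hr, hball⟩ := Metric.eventually_nhds_iff_ball.1 hev
  obtain ⟨δ, hδ, hδr, hδε⟩ : ∃ δ : ℝ, 0 < δ ∧ 2 * δ < r ∧ 2 * δ ≤ ε :=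
    ⟨min r ε / 4, by positivity, by linarith [min_le_left r ε], by linarith [min_le_right r ε]⟩
  have hvb : ∀ x ∈ Metric.ball (0 : E) r, ‖v x‖ ≤ c * ‖x‖ := by
    intro x hx
    have := (convex_ball (0 : E) r).norm_image_sub_le_of_norm_fderiv_le (𝕜 := ℝ) (f := v) (C := c)
      (fun y hy => hvd y (hball y hy).1) (fun y hy => (hball y hy).2.le)
      (Metric.mem_ball_self hr) hx
    simpa [hv0] using this
  set ψ : E → ℝ := fun x => χ (δ⁻¹ • x) with hψ
  have hψs : ContDiff ℝ ∞ ψ := χ.contDiff.comp (contDiff_const.smul contDiff_id)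
  have hψ0 : ∀ x, 2 * δ ≤ ‖x‖ → ψ x = 0 := by
    intro x hx
    refine χ.zero_of_le_dist ?_
    rw [dist_zero_right, norm_smul, norm_inv, Real.norm_of_nonneg hδ.le]
    change 2 ≤ δ⁻¹ * ‖x‖
    rwa [inv_mul_eq_div, le_div_iff₀ hδ]
  have hψlip : LipschitzWith (C * ‖δ⁻¹‖₊) ψ := hC.comp (lipschitzWith_smul δ⁻¹)
  have hψd : ∀ x, ‖fderiv ℝ ψ x‖ ≤ C * δ⁻¹ := by
    intro x
    simpa [abs_of_pos hδ] using norm_fderiv_le_of_lipschitz ℝ hψlip (x₀ := x)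
  set u : E → E := fun x => ψ x • v x with hu
  have hout : ∀ x, 2 * δ < ‖x‖ → u =ᶠ[𝓝 x] fun _ => 0 := by
    intro x hx
    filter_upwards [continuousAt_const.eventually_lt continuous_norm.continuousAt hx] with y hy
    simp [hu, hψ0 y hy.le]
  have hin : ∀ x : E, ‖x‖ ≤ 2 * δ → x ∈ Metric.ball (0 : E) r := fun x hx => by
    rw [mem_ball_zero_iff]; linarith
  have hus : ContDiff ℝ ∞ u := contDiff_iff_contDiffAt.2 fun x => by
    rcases lt_or_ge (2 * δ) ‖x‖ with hx | hx
    · exact contDiffAt_const.congr_of_eventuallyEq (hout x hx)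
    · exact hψs.contDiffAt.smul (hvW.contDiffAt (hW.mem_nhds (hball x (hin x hx)).1))
  have hud : ∀ x, ‖fderiv ℝ u x‖ ≤ 1 / 2 := by
    intro x
    rcases lt_or_ge (2 * δ) ‖x‖ with hx | hx
    · rw [(hout x hx).fderiv_eq]; simp
    · have hb := hball x (hin x hx)
      have hder : fderiv ℝ u x = ψ x • fderiv ℝ v x + (fderiv ℝ ψ x).smulRight (v x) :=
        ((hψs.differentiable (by simp) x).hasFDerivAt.smul (hvd x hb.1).hasFDerivAt).fderiv
      rw [hder]
      have h1 : ‖ψ x • fderiv ℝ v x‖ ≤ c := by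
        rw [norm_smul, Real.norm_of_nonneg χ.nonneg]
        calc ψ x * ‖fderiv ℝ v x‖ ≤ 1 * c :=
              mul_le_mul χ.le_one hb.2.le (norm_nonneg _) zero_le_one
          _ = c := one_mul c
      have h2 : ‖(fderiv ℝ ψ x).smulRight (v x)‖ ≤ 2 * C * c := by
        rw [ContinuousLinearMap.norm_smulRight_apply]
        calc ‖fderiv ℝ ψ x‖ * ‖v x‖ ≤ (C * δ⁻¹) * (c * (2 * δ)) := by
              refine mul_le_mul (hψd x) ((hvb x (hin x hx)).trans ?_) (norm_nonneg _)
                (by positivity)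
              gcongr
          _ = 2 * C * c := by field_simp
      calc _ ≤ c + 2 * C * c := (norm_add_le _ _).trans (add_le_add h1 h2)
        _ = 1 / 2 := by rw [hcdef]; field_simp; ring
  refine ⟨_, isBallDiffeotopy_id_add_smul hus hud (by simp [hu, hv0])
    fun y hy => by simp [hu, hψ0 y (hδε.trans hy)], ?_⟩
  have : ∀ᶠ x in 𝓝 (0 : E), ‖x‖ < δ :=
    continuous_norm.continuousAt.eventually_lt continuousAt_const (by simpa using hδ)
  filter_upwards [this] with x hx
  have hone : ψ x = 1 := by
    refine χ.one_of_mem_closedBall ?_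
    rw [mem_closedBall_zero_iff, norm_smul, norm_inv, Real.norm_of_nonneg hδ.le]
    change δ⁻¹ * ‖x‖ ≤ 1
    rw [inv_mul_eq_div, div_le_one hδ]
    exact hx.le
  simp [hu, hone, hv]

end Diffeotopy

/-! ### Realizable linear maps -/

section Linear

variable {E : Type*} [NormedAddCommGroup E] [NormedSpace ℝ E]

theorem isRealizable_id : IsRealizable (id : E → E) := fun ε _ =>
  ⟨fun _ y => y, ⟨contDiff_snd, fun _ _ => ⟨Diffeomorph.refl _ E _, fun _ => rfl⟩, fun _ => rfl,
    fun _ _ _ => rfl, fun _ => rfl, fun t _ y => by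
      have : fderiv ℝ (fun y : E => y) y = ContinuousLinearMap.id ℝ E := fderiv_fun_id
      rw [this]; simp [ContinuousLinearMap.det]⟩, Filter.EventuallyEq.rfl⟩

/-- The invertible operators that are, together with their inverses, realizable. -/
def realizableUnits (E : Type*) [NormedAddCommGroup E] [NormedSpace ℝ E] :
    Subgroup (E →L[ℝ] E)ˣ where
  carrier := {A | IsRealizable (A : E →L[ℝ] E) ∧ IsRealizable (↑A⁻¹ : E →L[ℝ] E)}
  mul_mem' {A B} hA hB := ⟨hA.1.comp hB.1, by
    rw [mem_ofPred_eq] at hA hB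
    rw [mul_inv_rev]; exact hB.2.comp hA.2⟩
  one_mem' := by
    rw [mem_ofPred_eq, inv_one]
    exact ⟨isRealizable_id, isRealizable_id⟩
  inv_mem' {A} hA := ⟨hA.2, by rw [inv_inv]; exact hA.1⟩

variable [FiniteDimensional ℝ E]

theorem isClopen_realizableUnits : IsClopen (realizableUnits E : Set (E →L[ℝ] E)ˣ) := by
  have : CompleteSpace E := FiniteDimensional.complete ℝ E
  obtain ⟨c, hc, h⟩ := exists_pos_forall_isRealizable_of_fderiv_near_id (E := E)
  have key : ∀ A : E →L[ℝ] E, ‖A - 1‖ < c → IsRealizable A := fun A hA =>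
    h A univ isOpen_univ (mem_univ _) A.contDiff.contDiffOn A.map_zero (by rwa [A.fderiv])
  have hnear : ∀ᶠ A : E →L[ℝ] E in 𝓝 1, ‖A - 1‖ < c := by
    filter_upwards [Metric.ball_mem_nhds (1 : E →L[ℝ] E) hc] with A hA
    rwa [← dist_eq_norm]
  have ho : IsOpen (realizableUnits E : Set (E →L[ℝ] E)ˣ) := by
    refine Subgroup.isOpen_of_mem_nhds _ (g := 1) ?_
    have h1 : Filter.Tendsto (fun A : (E →L[ℝ] E)ˣ => (A : E →L[ℝ] E)) (𝓝 1) (𝓝 1) :=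
      Units.continuous_val.tendsto 1
    have h2 : Filter.Tendsto (fun A : (E →L[ℝ] E)ˣ => (↑A⁻¹ : E →L[ℝ] E)) (𝓝 1) (𝓝 1) := by
      simpa [Function.comp_def] using
        (Units.continuous_val.comp continuous_inv).tendsto (1 : (E →L[ℝ] E)ˣ)
    filter_upwards [h1.eventually hnear, h2.eventually hnear] with A hA hA'
    exact ⟨key _ hA, key _ hA'⟩
  -- The complement of an open subgroup is a union of open cosets.
  exact ⟨Subgroup.isClosed_of_isOpen _ ho, ho⟩

theorem isRealizable_of_isUnit_segment (A : E →L[ℝ] E)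
    (hA : ∀ t ∈ Icc (0 : ℝ) 1, IsUnit ((1 - t) • (1 : E →L[ℝ] E) + t • A)) : IsRealizable A := by
  have : CompleteSpace E := FiniteDimensional.complete ℝ E
  choose γ hγ using fun t : Icc (0 : ℝ) 1 => hA t t.2
  have hcont : Continuous γ := by
    rw [Units.isOpenEmbedding_val.isInducing.continuous_iff]
    have : (Units.val ∘ γ) = fun t : Icc (0 : ℝ) 1 =>
        (1 - (t : ℝ)) • (1 : E →L[ℝ] E) + (t : ℝ) • A := funext hγ
    rw [this]
    fun_prop
  have h0 : γ ⟨0, by simp⟩ ∈ realizableUnits E := by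
    have : γ ⟨0, by simp⟩ = 1 := Units.ext (by simp [hγ])
    rw [this]; exact one_mem _
  have huniv : γ ⁻¹' (realizableUnits E : Set (E →L[ℝ] E)ˣ) = univ :=
    (isClopen_realizableUnits.preimage hcont).eq_univ ⟨_, h0⟩
  have h1 : γ ⟨1, by simp⟩ ∈ realizableUnits E := huniv.ge (mem_univ _)
  have := h1.1
  simpa [hγ] using this

end Linear

/-! ### Generating the matrices of positive determinant -/

section Matrix

open Matrix

/-- The triple product is a quarter turn in the `(i, j)` plane, so its square is the half turn. This
writes a pair of sign changes as a product of transvections. -/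
theorem Matrix.transvection_rotation_sq {n : Type*} [Fintype n] [DecidableEq n] {i j : n}
    (hij : i ≠ j) :
    (transvection i j (1 : ℝ) * transvection j i (-1) * transvection i j 1) *
      (transvection i j (1 : ℝ) * transvection j i (-1) * transvection i j 1) =
    diagonal fun k => if k = i ∨ k = j then -1 else 1 := by
  set a : Matrix n n ℝ := single i j 1 with ha
  set b : Matrix n n ℝ := single j i 1 with hb
  set p : Matrix n n ℝ := single i i 1 with hp
  set q : Matrix n n ℝ := single j j 1 with hq
  have hn : single j i (-1 : ℝ) = -b := by rw [hb, ← single_neg]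
  have hR : transvection i j (1 : ℝ) * transvection j i (-1) * transvection i j 1
      = 1 - p - q + a - b := by
    simp only [transvection, hn, ← ha]
    have haa : a * a = 0 := by simp [ha, hij.symm]
    have hab : a * b = p := by simp [ha, hb, hp]
    have hba : b * a = q := by simp [ha, hb, hq]
    have hpa : p * a = a := by simp [ha, hp]
    simp only [mul_add, add_mul, mul_one, one_mul, mul_neg, neg_mul, haa, hab, hba, hpa]
    abel
  rw [hR]
  have : (diagonal fun k => if k = i ∨ k = j then (-1 : ℝ) else 1) = 1 - p - p - q - q := by
    ext k l
    by_cases hkl : k = l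
    · subst hkl
      by_cases hki : k = i
      · subst hki; simp [hp, hq, hij.symm]
      · by_cases hkj : k = j
        · subst hkj; simp [hp, hq, hij]
        · simp [hp, hq, Ne.symm hki, Ne.symm hkj, hki, hkj]
    · have h1 : ¬ (i = k ∧ i = l) := fun h => hkl (h.1.symm.trans h.2)
      have h2 : ¬ (j = k ∧ j = l) := fun h => hkl (h.1.symm.trans h.2)
      simp [hp, hq, hkl, h1, h2]
  rw [this]
  have e1 : a * a = 0 := by simp [ha, hij.symm]
  have e2 : b * b = 0 := by simp [hb, hij]
  have e3 : a * b = p := by simp [ha, hb, hp]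
  have e4 : b * a = q := by simp [ha, hb, hq]
  have e5 : p * p = p := by simp [hp]
  have e6 : q * q = q := by simp [hq]
  have e7 : p * q = 0 := by simp [hp, hq, hij]
  have e8 : q * p = 0 := by simp [hp, hq, hij.symm]
  have e9 : p * a = a := by simp [ha, hp]
  have e10 : a * p = 0 := by simp [ha, hp, hij.symm]
  have e11 : q * a = 0 := by simp [ha, hq, hij.symm]
  have e12 : a * q = a := by simp [ha, hq]
  have e13 : p * b = 0 := by simp [hb, hp, hij]
  have e14 : b * p = b := by simp [hb, hp]
  have e15 : q * b = b := by simp [hb, hq]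
  have e16 : b * q = 0 := by simp [hb, hq, hij]
  simp only [mul_add, add_mul, mul_sub, sub_mul, mul_one, one_mul, e1, e2, e3, e4, e5, e6, e7, e8,
    e9, e10, e11, e12, e13, e14, e15, e16]
  abel

/-- A property of real matrices which is multiplicative and holds for matrices joined to `1` by a
segment of invertible matrices holds for all matrices of positive determinant. -/
theorem Matrix.induction_of_det_pos {n : Type*} [Fintype n] [DecidableEq n]
    (P : Matrix n n ℝ → Prop) (hmul : ∀ A B, P A → P B → P (A * B))
    (hseg : ∀ A : Matrix n n ℝ,
      (∀ t ∈ Icc (0 : ℝ) 1, IsUnit ((1 - t) • (1 : Matrix n n ℝ) + t • A)) → P A)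
    (M : Matrix n n ℝ) (hM : 0 < M.det) : P M := by
  have htrans : ∀ (i j : n), i ≠ j → ∀ c, P (transvection i j c) := by
    intro i j hij c
    refine hseg _ fun t _ => ?_
    have : (1 - t) • (1 : Matrix n n ℝ) + t • transvection i j c = transvection i j (t * c) := by
      simp only [transvection, smul_add, smul_single, smul_eq_mul]
      module
    rw [this, isUnit_iff_isUnit_det, det_transvection_of_ne i j hij]
    exact isUnit_one
  have hdiag : ∀ (k : ℕ) (D : n → ℝ), (Finset.univ.filter fun i => D i < 0).card = k →
      0 < ∏ i, D i → P (diagonal D) := by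
    intro k
    -- Induction on the number of negative entries: a half turn removes two at a time, and with none
    -- left the segment to `1` stays invertible.
    induction k using Nat.strong_induction_on with
    | _ k ih =>
      intro D hk hD
      have hne : ∀ i, D i ≠ 0 := fun i h =>
        hD.ne' (Finset.prod_eq_zero (Finset.mem_univ i) h)
      by_cases hpos : ∀ i, 0 < D i
      · refine hseg _ fun t ht => ?_
        have : (1 - t) • (1 : Matrix n n ℝ) + t • diagonal D
            = diagonal fun i => (1 - t) + t * D i := by
          ext a b
          by_cases hab : a = b
          · subst hab; simp
          · simp [hab]
        rw [this, isUnit_iff_isUnit_det, det_diagonal, isUnit_iff_ne_zero]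
        refine Finset.prod_ne_zero_iff.2 fun i _ => ne_of_gt ?_
        rcases ht.1.eq_or_lt with h | h
        · rw [← h]; norm_num
        · have := mul_pos h (hpos i)
          linarith [ht.2]
      · push Not at hpos
        obtain ⟨i, hi⟩ := hpos
        have hi' : D i < 0 := lt_of_le_of_ne hi (hne i)
        -- A lone negative entry would make the product negative.
        obtain ⟨j, hji, hj'⟩ : ∃ j, j ≠ i ∧ D j < 0 := by
          by_contra! hcon
          have hp : 0 < ∏ l ∈ Finset.univ.erase i, D l := Finset.prod_pos fun l hl =>
            lt_of_le_of_ne (hcon l (Finset.ne_of_mem_erase hl)) (hne l).symm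
          rw [← Finset.mul_prod_erase _ _ (Finset.mem_univ i)] at hD
          exact absurd hD (not_lt.2 (mul_nonpos_of_nonpos_of_nonneg hi hp.le))
        set s : n → ℝ := fun l => if l = i ∨ l = j then -1 else 1 with hs
        have hsplit : diagonal D = diagonal (fun l => D l * s l) * diagonal s := by
          rw [diagonal_mul_diagonal]
          congr 1
          ext l
          by_cases hl : l = i ∨ l = j <;> simp [hs, hl]
        have hPs : P (diagonal s) := by
          rw [hs, ← transvection_rotation_sq hji.symm]
          have hJ := hmul _ _ (hmul _ _ (htrans i j hji.symm 1) (htrans j i hji (-1)))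
            (htrans i j hji.symm 1)
          exact hmul _ _ hJ hJ
        have hdets : ∏ l, s l = 1 := by
          rw [← det_diagonal, hs, ← transvection_rotation_sq hji.symm]
          simp [det_transvection_of_ne _ _ hji, det_transvection_of_ne _ _ hji.symm]
        rw [hsplit]
        refine hmul _ _ (ih _ ?_ _ rfl ?_) hPs
        · rw [← hk]
          refine Finset.card_lt_card (Finset.ssubset_iff_of_subset ?_ |>.2 ⟨i, ?_, ?_⟩)
          · intro l hl
            simp only [Finset.mem_filter, Finset.mem_univ, true_and] at hl ⊢
            by_cases hl' : l = i ∨ l = j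
            · rcases hl' with rfl | rfl <;> assumption
            · simpa [hs, hl'] using hl
          · simpa using hi'
          · simpa [hs] using hi'.le
        · rw [Finset.prod_mul_distrib, hdets, mul_one]
          exact hD
  exact diagonal_transvection_induction P M
    (fun D hD => hdiag _ D rfl (by rwa [← det_diagonal, hD]))
    (fun t => htrans _ _ t.hij _) hmul

theorem EuclideanSpace.isRealizable_of_det_pos {n : ℕ}
    (A : EuclideanSpace ℝ (Fin n) →L[ℝ] EuclideanSpace ℝ (Fin n)) (hA : 0 < A.det) :
    IsRealizable A := by
  let φ := toEuclideanCLM (n := Fin n) (𝕜 := ℝ)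
  have key : ∀ M : Matrix (Fin n) (Fin n) ℝ, 0 < M.det → IsRealizable (φ M) := by
    refine Matrix.induction_of_det_pos (fun M => IsRealizable (φ M)) ?_ ?_
    · intro M N hM hN
      rw [map_mul]
      exact hM.comp hN
    · intro M hM
      refine isRealizable_of_isUnit_segment _ fun t ht => ?_
      simpa using (hM t ht).map φ
  have hdet : (φ.symm A).det = A.det := by
    have h := LinearMap.det_toLin (EuclideanSpace.basisFun (Fin n) ℝ).toBasis (φ.symm A)
    rw [← h, ContinuousLinearMap.det]
    congr 1
    rw [← toEuclideanLin_eq_toLin_orthonormal, ← coe_toEuclideanCLM_eq_toEuclideanLin]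
    exact congrArg _ (φ.apply_symm_apply A)
  have := key (φ.symm A) (by rwa [hdet])
  rwa [φ.apply_symm_apply] at this

end Matrix

/-! ### Orientation-preserving germs -/

/-- Factor `g = A ∘ (A⁻¹ ∘ g)` with `A` its derivative at the origin: the second factor has
derivative exactly the identity, and `A` has positive determinant. -/
theorem EuclideanSpace.isRealizable_of_det_fderiv_pos {n : ℕ}
    {g : EuclideanSpace ℝ (Fin n) → EuclideanSpace ℝ (Fin n)} {W : Set (EuclideanSpace ℝ (Fin n))}
    (hW : IsOpen W) (h0 : 0 ∈ W) (hg : ContDiffOn ℝ ∞ g W) (hg0 : g 0 = 0)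
    (hdet : 0 < (fderiv ℝ g 0).det) : IsRealizable g := by
  obtain ⟨c, hc, h⟩ :=
    exists_pos_forall_isRealizable_of_fderiv_near_id (E := EuclideanSpace ℝ (Fin n))
  set A := (fderiv ℝ g 0).toContinuousLinearEquivOfDetNeZero hdet.ne' with hA
  have hAcoe : (A : EuclideanSpace ℝ (Fin n) →L[ℝ] EuclideanSpace ℝ (Fin n)) = fderiv ℝ g 0 :=
    ContinuousLinearMap.coe_toContinuousLinearEquivOfDetNeZero _ _
  have hgd : HasFDerivAt g (A : EuclideanSpace ℝ (Fin n) →L[ℝ] EuclideanSpace ℝ (Fin n)) 0 := by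
    rw [hAcoe]
    exact ((hg.contDiffAt (hW.mem_nhds h0)).differentiableAt (by simp)).hasFDerivAt
  have hder : fderiv ℝ (A.symm ∘ g) 0 = ContinuousLinearMap.id ℝ _ := by
    rw [(A.symm.hasFDerivAt.comp 0 hgd).fderiv]
    exact A.coe_symm_comp_coe
  have h1 : IsRealizable (A.symm ∘ g) :=
    h _ W hW h0 (A.symm.contDiff.comp_contDiffOn hg) (by simp [hg0]) (by simpa [hder] using hc)
  have h2 := (EuclideanSpace.isRealizable_of_det_pos (fderiv ℝ g 0) hdet).comp h1
  refine h2.congr (Filter.Eventually.of_forall fun x => ?_)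
  rw [← hAcoe]
  simp

/-! ### Embeddings of the disk -/

section Disk

variable {n : ℕ}

theorem ball_subset_interior_disk : Metric.ball 0 1 ⊆ interior (Disk n) :=
  Metric.isOpen_ball.subset_interior_iff.2 Metric.ball_subset_closedBall

theorem disk_mem_nhds {x : EuclideanSpace ℝ (Fin n)} (hx : x ∈ Metric.ball 0 1) :
    Disk n ∈ 𝓝 x :=
  mem_interior_iff_mem_nhds.1 (ball_subset_interior_disk hx)

theorem uniqueDiffOn_disk : UniqueDiffOn ℝ (Disk n) :=
  uniqueDiffOn_convex (convex_closedBall 0 1)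
    ⟨0, ball_subset_interior_disk (Metric.mem_ball_self one_pos)⟩

variable {f f₁ f₂ : EuclideanSpace ℝ (Fin n) → EuclideanSpace ℝ (Fin n)}

theorem IsSmoothDiskEmbedding.contDiffAt (hf : IsSmoothDiskEmbedding f)
    {x : EuclideanSpace ℝ (Fin n)} (hx : x ∈ Metric.ball 0 1) : ContDiffAt ℝ ∞ f x :=
  hf.smooth.contDiffAt (disk_mem_nhds hx)

theorem IsSmoothDiskEmbedding.injOn (hf : IsSmoothDiskEmbedding f) : InjOn f (Disk n) :=
  injOn_iff_injective.2 hf.embedding.injective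

theorem IsOrientationPreservingOnDisk.det_fderiv_pos (ho : IsOrientationPreservingOnDisk f)
    {x : EuclideanSpace ℝ (Fin n)} (hx : x ∈ Metric.ball 0 1) : 0 < (fderiv ℝ f x).det := by
  rw [← fderivWithin_of_mem_nhds (disk_mem_nhds hx)]
  exact ho x (Metric.ball_subset_closedBall hx)

theorem IsSmoothDiskEmbedding.hasFDerivAt_equiv (hf : IsSmoothDiskEmbedding f)
    (ho : IsOrientationPreservingOnDisk f) {x : EuclideanSpace ℝ (Fin n)}
    (hx : x ∈ Metric.ball 0 1) :
    HasFDerivAt f (((fderiv ℝ f x).toContinuousLinearEquivOfDetNeZero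
      (ho.det_fderiv_pos hx).ne' : EuclideanSpace ℝ (Fin n) ≃L[ℝ] EuclideanSpace ℝ (Fin n)) :
      EuclideanSpace ℝ (Fin n) →L[ℝ] EuclideanSpace ℝ (Fin n)) x := by
  rw [ContinuousLinearMap.coe_toContinuousLinearEquivOfDetNeZero]
  exact ((hf.contDiffAt hx).differentiableAt (by simp)).hasFDerivAt

/-- The transition germ `f₁ ∘ f₂⁻¹` of two embeddings of the disk is realizable. -/
theorem IsSmoothDiskEmbedding.exists_isRealizable_comp_eq
    (hf₁ : IsSmoothDiskEmbedding f₁) (hf₂ : IsSmoothDiskEmbedding f₂)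
    (ho₁ : IsOrientationPreservingOnDisk f₁) (ho₂ : IsOrientationPreservingOnDisk f₂)
    (h0₁ : f₁ 0 = 0) (h0₂ : f₂ 0 = 0) :
    ∃ g, IsRealizable g ∧ ∀ᶠ x in 𝓝 0, g (f₂ x) = f₁ x := by
  have hz : (0 : EuclideanSpace ℝ (Fin n)) ∈ Metric.ball 0 1 := Metric.mem_ball_self one_pos
  have hd₂ := hf₂.hasFDerivAt_equiv ho₂ hz
  set e := (hf₂.contDiffAt hz).toOpenPartialHomeomorph f₂ hd₂ (by simp) with he
  have hecoe : ∀ x, e x = f₂ x := fun _ => rfl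
  have hsrc : 0 ∈ e.source := (hf₂.contDiffAt hz).mem_toOpenPartialHomeomorph_source hd₂ (by simp)
  have htgt : 0 ∈ e.target := by
    have := e.map_source hsrc
    rwa [hecoe, h0₂] at this
  have hsymm0 : e.symm 0 = 0 := by
    have := e.left_inv hsrc
    rwa [hecoe, h0₂] at this
  -- Preimages are kept in the open ball, where `f₁` is smooth and `f₂` has an invertible
  -- derivative.
  set W := e.target ∩ e.symm ⁻¹' Metric.ball 0 1 with hWdef
  have hW : IsOpen W := e.isOpen_inter_preimage_symm Metric.isOpen_ball
  have h0W : 0 ∈ W := ⟨htgt, by rw [mem_preimage, hsymm0]; exact hz⟩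
  have hsm : ∀ y ∈ W, ContDiffAt ℝ ∞ e.symm y := fun y hy =>
    e.contDiffAt_symm hy.1 (hf₂.hasFDerivAt_equiv ho₂ hy.2) (hf₂.contDiffAt hy.2)
  have hsmg : ContDiffOn ℝ ∞ (f₁ ∘ e.symm) W := fun y hy =>
    ((hf₁.contDiffAt hy.2).comp y (hsm y hy)).contDiffWithinAt
  have hleft : ∀ᶠ x in 𝓝 0, (f₁ ∘ e.symm) (f₂ x) = f₁ x := by
    filter_upwards [e.open_source.mem_nhds hsrc] with x hx
    have := e.left_inv hx
    rw [hecoe] at this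
    rw [Function.comp, this]
  refine ⟨f₁ ∘ e.symm, ?_, hleft⟩
  have hg0 : (f₁ ∘ e.symm) 0 = 0 := by simp [hsymm0, h0₁]
  refine EuclideanSpace.isRealizable_of_det_fderiv_pos hW h0W hsmg hg0 ?_
  have hgd : HasFDerivAt (f₁ ∘ e.symm) (fderiv ℝ (f₁ ∘ e.symm) 0) (f₂ 0) := by
    rw [h0₂]
    exact ((hsmg.contDiffAt (hW.mem_nhds h0W)).differentiableAt (by simp)).hasFDerivAt
  -- Differentiating `g ∘ f₂ = f₁` gives the sign of the determinant of `g` without computing the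
  -- derivative of the local inverse.
  have hchain : fderiv ℝ f₁ 0 = (fderiv ℝ (f₁ ∘ e.symm) 0).comp (fderiv ℝ f₂ 0) := by
    have h := hgd.comp 0 ((hf₂.contDiffAt hz).differentiableAt (by simp)).hasFDerivAt
    exact (h.congr_of_eventuallyEq (hleft.mono fun x hx => hx.symm)).fderiv
  have hpos := ho₁.det_fderiv_pos hz
  rw [hchain, ContinuousLinearMap.det_mul'] at hpos
  exact pos_of_mul_pos_left hpos (ho₂.det_fderiv_pos hz).le

/-- By the inverse function theorem `f` maps neighbourhoods of `0` onto neighbourhoods of `0`. The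
radius `1 / 2` leaves a collar of the boundary sphere untouched. -/
theorem IsSmoothDiskEmbedding.exists_closedBall_subset_image (hf : IsSmoothDiskEmbedding f)
    (ho : IsOrientationPreservingOnDisk f) (h0 : f 0 = 0) :
    ∃ ε > 0, Metric.closedBall 0 ε ⊆ f '' Metric.closedBall 0 (1 / 2) := by
  have hz : (0 : EuclideanSpace ℝ (Fin n)) ∈ Metric.ball 0 1 := Metric.mem_ball_self one_pos
  have hs := (hf.contDiffAt hz).hasStrictFDerivAt' (hf.hasFDerivAt_equiv ho hz) (by simp)
  have hmap := hs.map_nhds_eq_of_equiv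
  rw [h0] at hmap
  have : f '' Metric.closedBall 0 (1 / 2) ∈ 𝓝 0 := by
    rw [← hmap]
    exact Filter.image_mem_map (Metric.closedBall_mem_nhds 0 (by norm_num))
  exact Metric.nhds_basis_closedBall.mem_iff.1 this

theorem IsBallDiffeotopy.fderivWithin_comp {ε : ℝ}
    {H : ℝ → EuclideanSpace ℝ (Fin n) → EuclideanSpace ℝ (Fin n)} (hH : IsBallDiffeotopy ε H)
    (hf : IsSmoothDiskEmbedding f) (t : ℝ) {x : EuclideanSpace ℝ (Fin n)} (hx : x ∈ Disk n) :
    fderivWithin ℝ (fun x => H t (f x)) (Disk n) x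
      = (fderiv ℝ (H t) (f x)).comp (fderivWithin ℝ f (Disk n) x) :=
  fderiv_comp_fderivWithin x ((hH.contDiff_apply t).differentiable (by simp) _)
    (hf.smooth.differentiableOn (by simp) x hx) (uniqueDiffOn_disk x hx)

theorem IsBallDiffeotopy.isSmoothDiskEmbedding_comp {ε : ℝ}
    {H : ℝ → EuclideanSpace ℝ (Fin n) → EuclideanSpace ℝ (Fin n)} (hH : IsBallDiffeotopy ε H)
    (hf : IsSmoothDiskEmbedding f) {t : ℝ} (ht : t ∈ Icc (0 : ℝ) 1) :
    IsSmoothDiskEmbedding (fun x => H t (f x)) where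
  smooth := (hH.contDiff_apply t).comp_contDiffOn hf.smooth
  immersion x hx := by
    rw [hH.fderivWithin_comp hf t hx]
    have hinj : Function.Injective (fderiv ℝ (H t) (f x)) := by
      rw [← ContinuousLinearMap.coe_toContinuousLinearEquivOfDetNeZero _
        (hH.det_pos t ht (f x)).ne']
      exact ContinuousLinearEquiv.injective _
    exact hinj.comp (hf.immersion x hx)
  embedding := by
    obtain ⟨Φ, hΦ⟩ := hH.diffeo t ht
    have h : (Disk n).domRestrict (fun x => H t (f x))
        = Φ.toHomeomorph ∘ (Disk n).domRestrict f := funext fun x => (hΦ (f x)).symm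
    rw [h]
    exact Φ.toHomeomorph.isEmbedding.comp hf.embedding

end Disk

/-! ### Assembling the isotopy -/

theorem theorem2p3p3 (n : ℕ)
    (f₁ f₂ : EuclideanSpace ℝ (Fin n) → EuclideanSpace ℝ (Fin n))
    (hf₁ : IsSmoothDiskEmbedding f₁) (hf₂ : IsSmoothDiskEmbedding f₂)
    (ho₁ : IsOrientationPreservingOnDisk f₁) (ho₂ : IsOrientationPreservingOnDisk f₂)
    (h0₁ : f₁ 0 = 0) (h0₂ : f₂ 0 = 0) :
    ∃ F : ℝ → EuclideanSpace ℝ (Fin n) → EuclideanSpace ℝ (Fin n),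
      IsDiskIsotopyOf F f₂ ∧
      (∀ t ∈ Icc (0 : ℝ) 1, IsOrientationPreservingOnDisk (F t) ∧ F t 0 = 0) ∧
      (∃ V : Set (EuclideanSpace ℝ (Fin n)), IsOpen V ∧ DiskBoundary n ⊆ V ∧
        ∀ t ∈ Icc (0 : ℝ) 1, ∀ x ∈ V ∩ Disk n, F t x = f₂ x) ∧
      (∃ U : Set (EuclideanSpace ℝ (Fin n)), IsOpen U ∧ 0 ∈ U ∧
        closure U ⊆ interior (Disk n) ∧ ∀ x ∈ U, F 1 x = f₁ x) ∧
      (∃ H : ℝ → EuclideanSpace ℝ (Fin n) → EuclideanSpace ℝ (Fin n),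
        IsDiffeotopy H ∧ diffeotopySupport H ⊆ f₂ '' Disk n ∧
        ∀ t ∈ Icc (0 : ℝ) 1, ∀ x ∈ Disk n, F t x = H t (f₂ x)) := by
  have hz : (0 : EuclideanSpace ℝ (Fin n)) ∈ Metric.ball 0 1 := Metric.mem_ball_self one_pos
  obtain ⟨g, hg, hgf⟩ := hf₁.exists_isRealizable_comp_eq hf₂ ho₁ ho₂ h0₁ h0₂
  obtain ⟨ε, hε, hball⟩ := hf₂.exists_closedBall_subset_image ho₂ h0₂
  obtain ⟨H, hH, hHg⟩ := hg ε hε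
  have hhalf : Metric.closedBall (0 : EuclideanSpace ℝ (Fin n)) (1 / 2) ⊆ Disk n :=
    Metric.closedBall_subset_closedBall (by norm_num)
  have hend : ∀ᶠ x in 𝓝 0, H 1 (f₂ x) = f₁ x := by
    have hc : Filter.Tendsto f₂ (𝓝 0) (𝓝 0) := by
      simpa [h0₂] using (hf₂.contDiffAt hz).continuousAt.tendsto
    filter_upwards [hc.eventually hHg, hgf] with x h1 h2
    rw [h1, h2]
  obtain ⟨r, hr, hrend⟩ := Metric.eventually_nhds_iff_ball.1 hend
  refine ⟨fun t x => H t (f₂ x), ⟨?_, fun t ht => hH.isSmoothDiskEmbedding_comp hf₂ ht,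
    fun x _ => hH.start _⟩, fun t ht => ⟨fun x hx => ?_, ?_⟩,
    ⟨{x | 1 / 2 < ‖x‖}, isOpen_lt continuous_const continuous_norm, fun x hx => ?_,
      fun t _ x hx => ?_⟩,
    ⟨Metric.ball 0 (min r (1 / 2)), Metric.isOpen_ball,
      Metric.mem_ball_self (lt_min hr (by norm_num)), ?_,
      fun x hx => hrend x (Metric.ball_subset_ball (min_le_left _ _) hx)⟩,
    H, ⟨hH.contDiff.contDiffOn, hH.diffeo, hH.start⟩, ?_, fun _ _ _ _ => rfl⟩
  · exact hH.contDiff.comp_contDiffOn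
      (contDiffOn_fst.prodMk (hf₂.smooth.comp contDiffOn_snd fun p hp => hp.2))
  · rw [hH.fderivWithin_comp hf₂ t hx, ContinuousLinearMap.det_mul']
    exact mul_pos (hH.det_pos t ht _) (ho₂ x hx)
  · simp [h0₂, hH.map_zero]
  · have : ‖x‖ = 1 := by simpa [DiskBoundary] using hx
    rw [mem_ofPred_eq, this]
    norm_num
  -- If `f₂ x` lay in the `ε`-ball it would be the image of a point of norm at most `1 / 2`, which
  -- by injectivity is `x` itself, contradicting that `x` is in the collar.
  · refine hH.eq_self t _ ?_
    by_contra! hlt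
    obtain ⟨x', hx', hxx'⟩ := hball (mem_closedBall_zero_iff.2 hlt.le)
    have := hf₂.injOn (hhalf hx') hx.2 hxx'
    rw [this, mem_closedBall_zero_iff] at hx'
    exact absurd hx.1 (not_lt.2 hx')
  · refine (Metric.closure_ball_subset_closedBall.trans ?_).trans ball_subset_interior_disk
    exact Metric.closedBall_subset_ball (lt_of_le_of_lt (min_le_right _ _) (by norm_num))
  · refine (closure_minimal ?_ Metric.isClosed_closedBall).trans
      (hball.trans (image_mono hhalf))
    rintro y ⟨t, _, hty⟩
    rw [mem_closedBall_zero_iff]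
    by_contra! hlt
    exact hty (hH.eq_self t y hlt.le)
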